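/- For complex numbers $a_1,\dots,a_m,b_1,\dots,b_m,z$ with no $b_i$ equal to zero or a negative integer, let $$ {}_mF_m\!\left[\begin{array}{c} a_1,\dots,a_m\\ b_1,\dots,b_m\end{array}\Big|\;z\right]:=\sum_{k=0}^{\infty}\frac{(a_1)_k\cdots(a_m)_k}{(b_1)_k\cdots(b_m)_k}\,z^k, \qquad (x)_0=1,\quad (x)_k=x(x+1)\cdots(x+k-1) $$ (there is no extra $k!$ in the denominator). Let $a\in\mathbb{C}$ be such that $2a$ is not a nonzero integer; equivalently, none of the lower parameters below is zero or a negative integer. Then the following series converges absolutely, and $$ {}_6F_6\!\left[\begin{array}{cccccc} \frac14, & \frac34, & \frac14+a, & \frac34+a, & \frac14-a, & \frac34-a\\[2pt] 1, & \frac12, & 1-a, & \frac12-a, & 1+a, & \frac12+a\end{array}\Big|\;1\right] =\frac{\Gamma(1+2a)\,\Gamma(1-2a)}{4\pi}\left[\frac{\Gamma(\frac14)^2}{\Gamma(\frac34-2a)\,\Gamma(\frac34+2a)}+\frac{\sqrt2\,\pi^2}{\Gamma(a+\frac58)\,\Gamma(a+\frac78)\,\Gamma(-a+\frac58)\,\Gamma(-a+\frac78)}\right],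 $$ where $1/\Gamma$ denotes the entire function, so that $1/\Gamma(s)=0$ for $s=0,-1,-2,\dots$. -/

import Mathlib

/-- The rising factorial `(x)_k = x (x + 1) ⋯ (x + k - 1)`, with `(x)_0 = 1`. -/
noncomputable def risingFactorial (x : ℂ) (k : ℕ) : ℂ :=
  (ascPochhammer ℂ k).eval x

/-- The `k`-th term `((a₁)_k ⋯ (aₘ)_k) / ((b₁)_k ⋯ (bₘ)_k) * z ^ k` of the classical generalized
hypergeometric series with `m` upper and `m` lower parameters. There is no additional `k!` in the
denominator: it appears when one of the lower parameters is `1`. -/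
noncomputable def hypergeometricTerm {m : ℕ} (a b : Fin m → ℂ) (z : ℂ) (k : ℕ) : ℂ :=
  (∏ i, risingFactorial (a i) k) / (∏ i, risingFactorial (b i) k) * z ^ k

/-- The classical generalized hypergeometric series `ₘFₘ[a₁, …, aₘ; b₁, …, bₘ | z]`. -/
noncomputable def hypergeometricSeries {m : ℕ} (a b : Fin m → ℂ) (z : ℂ) : ℂ :=
  ∑' k : ℕ, hypergeometricTerm a b z k

/-!
By the duplication formula for rising factorials, the `k`-th term of the series is the term of index
`2 k` of the sequence `u n = (1/2)_n (1/2 + 2a)_n (1/2 - 2a)_n / (n! (1 - 2a)_n (1 + 2a)_n)`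
(`hypergeometricTerm_eq_specialTerm`), so the sum is half of `∑ u n + ∑ (-1) ^ n u n`. The two
summands give the two Gamma quotients.

Both series are well-poised. Inserting the very-well-poised factor `(1 + α/2)_n / (α/2)_n` and
cancelling it against parameters `1/4` (and `3/4`), they become the case `α = 1/2` of
`₅F₄(α; b, c, d; 1)` and `₆F₅(α; b, 1 - b, d, 1 - d; -1)`, which are summed in closed form in
`hasSum_wellPoisedTerm54` and `hasSum_wellPoisedTerm65`. The point of the extra parameter `α`, which
the original series does not have, is that it can be shifted to infinity: the terms for `α`
minus a rational multiple of those for `α + 1` (respectively `α + 2`) form a telescoping sequence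
with a rational certificate (`wellPoisedTerm54_telescope`, `wellPoisedTerm65_telescope`). As `α`
grows, all terms except the first vanish, uniformly enough for the sum to tend to `1`
(`tendsto_tsum_one_of_ratio`). The sum is therefore the infinite product of the rational factors
(`tsum_eq_of_telescoping`), which Euler's limit formula for `1 / Γ` evaluates
(`tendsto_prod_range_div`). Since that formula holds for the entire function `1 / Γ`, vanishing
reciprocal Gamma values in the result need no separate treatment.
-/

open Filter Topology

/-! ### Rising factorials -/

@[simp] lemma risingFactorial_zero (x : ℂ) : risingFactorial x 0 = 1 := by
  simp [risingFactorial]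

lemma risingFactorial_succ (x : ℂ) (n : ℕ) :
    risingFactorial x (n + 1) = risingFactorial x n * (x + n) :=
  ascPochhammer_succ_eval n x

lemma risingFactorial_eq_prod (x : ℂ) (n : ℕ) :
    risingFactorial x n = ∏ j ∈ Finset.range n, (x + j) := by
  induction n with
  | zero => simp
  | succ n ih => rw [risingFactorial_succ, Finset.prod_range_succ, ih]

lemma risingFactorial_ne_zero {x : ℂ} (hx : ∀ n : ℕ, x + n ≠ 0) (n : ℕ) :
    risingFactorial x n ≠ 0 := by
  rw [risingFactorial_eq_prod]
  exact Finset.prod_ne_zero_iff.mpr fun j _ => hx j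

lemma mul_risingFactorial_add_one (x : ℂ) (n : ℕ) :
    x * risingFactorial (x + 1) n = risingFactorial x n * (x + n) := by
  induction n with
  | zero => simp
  | succ n ih =>
    rw [risingFactorial_succ, risingFactorial_succ, ← mul_assoc, ih]
    push_cast
    ring

lemma risingFactorial_two_mul (x : ℂ) (n : ℕ) :
    risingFactorial x (2 * n) =
      4 ^ n * risingFactorial (x / 2) n * risingFactorial ((x + 1) / 2) n := by
  induction n with
  | zero => simp
  | succ n ih =>
    rw [show 2 * (n + 1) = 2 * n + 1 + 1 by ring, risingFactorial_succ, risingFactorial_succ, ih,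
      risingFactorial_succ, risingFactorial_succ]
    push_cast
    ring

lemma add_natCast_ne_zero_of_re_pos {x : ℂ} (hx : 0 < x.re) (n : ℕ) : x + n ≠ 0 := by
  intro h
  have h1 := congrArg Complex.re h
  simp only [Complex.add_re, Complex.natCast_re, Complex.zero_re] at h1
  have : (0 : ℝ) ≤ n := n.cast_nonneg
  linarith

lemma add_natCast_add_natCast_ne_zero {x : ℂ} (hx : ∀ n : ℕ, x + n ≠ 0) (N n : ℕ) :
    x + N + n ≠ 0 := by
  have := hx (N + n)
  push_cast at this
  rwa [← add_assoc] at this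

lemma half_add_natCast_ne_zero {x : ℂ} (hx : ∀ n : ℕ, x + n ≠ 0) (n : ℕ) : x / 2 + n ≠ 0 := by
  have := hx (2 * n)
  push_cast at this
  intro h
  apply this
  linear_combination 2 * h

lemma add_one_half_add_natCast_ne_zero {x : ℂ} (hx : ∀ n : ℕ, x + n ≠ 0) (n : ℕ) :
    (x + 1) / 2 + n ≠ 0 := by
  refine half_add_natCast_ne_zero (fun k => ?_) n
  have := add_natCast_add_natCast_ne_zero hx 1 k
  simpa using this

lemma risingFactorial_one_add_div {x : ℂ} (hx : ∀ n : ℕ, x + n ≠ 0) (n : ℕ) :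
    risingFactorial (1 + x) n / risingFactorial x n = (x + n) / x := by
  have hx0 : x ≠ 0 := by simpa using hx 0
  rw [div_eq_div_iff (risingFactorial_ne_zero hx n) hx0, add_comm 1 x, mul_comm,
    mul_risingFactorial_add_one, mul_comm]

lemma inv_risingFactorial_add_one {x : ℂ} (hx : ∀ n : ℕ, x + n ≠ 0) (n : ℕ) :
    (risingFactorial (x + 1) n)⁻¹ = (risingFactorial x n)⁻¹ * (x * (x + n)⁻¹) := by
  have hx0 : x ≠ 0 := by simpa using hx 0
  have h1 := risingFactorial_ne_zero hx n
  have hn := hx n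
  rw [eq_div_of_mul_eq hx0 ((mul_comm _ _).trans (mul_risingFactorial_add_one x n))]
  field_simp

/-! ### Asymptotics of quotients of rising factorials -/

/-- Euler's limit formula for the entire function `1 / Γ`; it holds at the poles of `Γ` too. -/
lemma tendsto_inv_GammaSeq (s : ℂ) :
    Tendsto (fun n : ℕ => (Complex.GammaSeq s n)⁻¹) atTop (𝓝 (Complex.Gamma s)⁻¹) := by
  by_cases h : Complex.Gamma s = 0
  · obtain ⟨m, rfl⟩ := (Complex.Gamma_eq_zero_iff s).mp h
    rw [h, inv_zero]
    refine tendsto_const_nhds.congr' ?_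
    filter_upwards [eventually_ge_atTop m] with n hn
    have : ∏ j ∈ Finset.range (n + 1), (-(m : ℂ) + j) = 0 :=
      Finset.prod_eq_zero (Finset.mem_range.mpr (Nat.lt_succ_of_le hn)) (by simp)
    simp [Complex.GammaSeq, this]
  · exact (Complex.GammaSeq_tendsto_Gamma s).inv₀ h

/-- A quotient of rising factorials grows like a power of `n`, with a constant given by
Gamma functions. -/
lemma tendsto_risingFactorial_div (x y : ℂ) (hy : ∀ n : ℕ, y + n ≠ 0) :
    Tendsto (fun n : ℕ => risingFactorial x (n + 1) / risingFactorial y (n + 1) *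
      (n : ℂ) ^ (y - x)) atTop (𝓝 (Complex.Gamma y / Complex.Gamma x)) := by
  have h := (Complex.GammaSeq_tendsto_Gamma y).mul (tendsto_inv_GammaSeq x)
  rw [← div_eq_mul_inv] at h
  refine h.congr' ?_
  filter_upwards [eventually_ne_atTop 0] with n hn
  have hn' : (n : ℂ) ≠ 0 := Nat.cast_ne_zero.mpr hn
  have h1 : (n : ℂ) ^ x ≠ 0 := by simp [Complex.cpow_eq_zero_iff, hn']
  have h2 : (n.factorial : ℂ) ≠ 0 := Nat.cast_ne_zero.mpr n.factorial_ne_zero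
  have h3 := risingFactorial_ne_zero hy (n + 1)
  rw [Complex.GammaSeq, Complex.GammaSeq, ← risingFactorial_eq_prod, ← risingFactorial_eq_prod,
    Complex.cpow_sub _ _ hn', inv_div]
  field_simp

lemma tendsto_prod_risingFactorial_div {m : ℕ} (x y : Fin m → ℂ) (hy : ∀ i, ∀ n : ℕ, y i + n ≠ 0) :
    Tendsto (fun n : ℕ => (∏ i, risingFactorial (x i) (n + 1)) /
      (∏ i, risingFactorial (y i) (n + 1)) * (n : ℂ) ^ (∑ i, y i - ∑ i, x i)) atTop
      (𝓝 ((∏ i, Complex.Gamma (y i)) / ∏ i, Complex.Gamma (x i))) := by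
  rw [← Finset.prod_div_distrib]
  refine (tendsto_finsetProd Finset.univ fun i _ =>
    tendsto_risingFactorial_div (x i) (y i) (hy i)).congr' ?_
  filter_upwards [eventually_ne_atTop 0] with n hn
  have hn' : (n : ℂ) ≠ 0 := Nat.cast_ne_zero.mpr hn
  rw [Finset.prod_mul_distrib, Finset.prod_div_distrib, ← Finset.sum_sub_distrib,
    Complex.cpow_def_of_ne_zero hn', Finset.mul_sum, Complex.exp_sum]
  simp_rw [Complex.cpow_def_of_ne_zero hn']

/-- An infinite product of quotients of linear factors with equal sums of parameters is a quotient
of Gamma values. -/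
lemma tendsto_prod_range_div {m : ℕ} (x y : Fin m → ℂ) (hy : ∀ i, ∀ n : ℕ, y i + n ≠ 0)
    (hxy : ∑ i, x i = ∑ i, y i) :
    Tendsto (fun N : ℕ => ∏ j ∈ Finset.range N, (∏ i, (x i + j)) / ∏ i, (y i + j)) atTop
      (𝓝 ((∏ i, Complex.Gamma (y i)) / ∏ i, Complex.Gamma (x i))) := by
  rw [← tendsto_add_atTop_iff_nat 1]
  have h := tendsto_prod_risingFactorial_div x y hy
  simp only [hxy, sub_self, Complex.cpow_zero, mul_one] at h
  refine h.congr fun N => ?_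
  rw [Finset.prod_div_distrib, Finset.prod_comm, Finset.prod_comm (s := Finset.range (N + 1))]
  simp_rw [risingFactorial_eq_prod]

/-! ### Hypergeometric terms -/

lemma hypergeometricTerm_zero {m : ℕ} (x y : Fin m → ℂ) (z : ℂ) :
    hypergeometricTerm x y z 0 = 1 := by
  simp [hypergeometricTerm]

lemma hypergeometricTerm_succ {m : ℕ} (x y : Fin m → ℂ) (z : ℂ) (k : ℕ) :
    hypergeometricTerm x y z (k + 1) =
      hypergeometricTerm x y z k * ((∏ i, (x i + k)) / (∏ i, (y i + k)) * z) := by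
  simp only [hypergeometricTerm, risingFactorial_succ, Finset.prod_mul_distrib, pow_succ]
  rw [mul_div_mul_comm]
  ring

lemma hypergeometricTerm_isBigO {m : ℕ} (x y : Fin m → ℂ) (hy : ∀ i, ∀ n : ℕ, y i + n ≠ 0)
    {z : ℂ} (hz : ‖z‖ = 1) :
    (fun n : ℕ => hypergeometricTerm x y z (n + 1)) =O[atTop]
      fun n : ℕ => (n : ℝ) ^ (-(∑ i, y i - ∑ i, x i).re) := by
  have h := (tendsto_prod_risingFactorial_div x y hy).isBigO_one ℝ
  refine (Asymptotics.IsBigO.of_norm_left ?_)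
  have h2 := h.norm_left.mul (Asymptotics.isBigO_refl
    (fun n : ℕ => (n : ℝ) ^ (-(∑ i, y i - ∑ i, x i).re)) atTop)
  simp only [one_mul] at h2
  refine h2.congr' ?_ EventuallyEq.rfl
  filter_upwards [eventually_gt_atTop 0] with n hn
  have hn' : (0 : ℝ) < n := Nat.cast_pos.mpr hn
  rw [hypergeometricTerm, norm_mul, norm_mul, norm_pow, hz, one_pow, mul_one,
    Complex.norm_natCast_cpow_of_pos hn, mul_assoc, ← Real.rpow_add hn', add_neg_cancel,
    Real.rpow_zero, mul_one]

lemma summable_hypergeometricTerm {m : ℕ} (x y : Fin m → ℂ) (hy : ∀ i, ∀ n : ℕ, y i + n ≠ 0)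
    {z : ℂ} (hz : ‖z‖ = 1) (h : 1 < (∑ i, y i - ∑ i, x i).re) :
    Summable (hypergeometricTerm x y z) := by
  refine (summable_nat_add_iff 1).mp ?_
  refine summable_of_isBigO_nat ?_ (hypergeometricTerm_isBigO x y hy hz)
  exact Real.summable_nat_rpow.mpr (by linarith)

/-- Under the same condition that makes the series converge absolutely, its terms are `o(1 / n)`. -/
lemma tendsto_natCast_mul_hypergeometricTerm {m : ℕ} (x y : Fin m → ℂ)
    (hy : ∀ i, ∀ n : ℕ, y i + n ≠ 0)
    {z : ℂ} (hz : ‖z‖ = 1) (h : 1 < (∑ i, y i - ∑ i, x i).re) :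
    Tendsto (fun n : ℕ => (n : ℂ) * hypergeometricTerm x y z n) atTop (𝓝 0) := by
  rw [← tendsto_add_atTop_iff_nat 1]
  have h1 : (fun n : ℕ => ((n + 1 : ℕ) : ℂ)) =O[atTop] fun n : ℕ => (n : ℝ) := by
    refine Asymptotics.IsBigO.of_bound 2 ?_
    filter_upwards [eventually_ge_atTop 1] with n hn
    have : (1 : ℝ) ≤ n := by exact_mod_cast hn
    rw [Complex.norm_natCast, Real.norm_natCast]
    push_cast
    linarith
  refine (h1.mul (hypergeometricTerm_isBigO x y hy hz)).trans_tendsto ?_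
  have h2 := (tendsto_rpow_neg_atTop (y := (∑ i, y i - ∑ i, x i).re - 1) (by linarith)).comp
    (tendsto_natCast_atTop_atTop (R := ℝ))
  refine h2.congr' ?_
  filter_upwards [eventually_gt_atTop 0] with n hn
  have hn' : (0 : ℝ) < n := Nat.cast_pos.mpr hn
  simp only [Function.comp]
  rw [show -((∑ i, y i - ∑ i, x i).re - 1) = 1 + -(∑ i, y i - ∑ i, x i).re by ring,
    Real.rpow_add hn', Real.rpow_one]

/-! ### Telescoping in the parameter -/

/-- If the ratios of consecutive terms of a family of sequences are eventually at most
`exp (-K / (n + 1))` uniformly in `n`, for every `K`, then the sums tend to the first term. -/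
lemma tendsto_tsum_one_of_ratio (T ρ : ℕ → ℕ → ℂ) (h0 : ∀ N, T N 0 = 1)
    (hT : ∀ N n, T N (n + 1) = T N n * ρ N n)
    (hρ : ∀ K : ℝ, ∀ᶠ N in atTop, ∀ n : ℕ, ‖ρ N n‖ ≤ Real.exp (-K / (n + 1))) :
    Tendsto (fun N => ∑' n, T N n) atTop (𝓝 1) := by
  have hρ0 : Tendsto (fun N => ρ N 0) atTop (𝓝 0) := by
    refine NormedAddGroup.tendsto_nhds_zero.mpr fun ε hε => ?_
    filter_upwards [hρ (1 - Real.log ε)] with N hN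
    refine (hN 0).trans_lt ?_
    rw [← Real.lt_log_iff_exp_lt hε]
    simp
  -- `exp (-2 / (n + 1)) ≤ ((n + 1) / (n + 2)) ^ 2`, so the terms are dominated by `1 / n ^ 2`.
  have hexp : ∀ n : ℕ, Real.exp (-2 / (n + 1)) ≤ ((n + 1 : ℝ) / (n + 2)) ^ 2 := by
    intro n
    have hn : (0 : ℝ) < n + 1 := by positivity
    have h1 : (n + 2 : ℝ) / (n + 1) ≤ Real.exp (1 / (n + 1)) := by
      have := Real.add_one_le_exp (1 / (n + 1 : ℝ))
      rwa [show (n + 2 : ℝ) / (n + 1) = 1 / (n + 1) + 1 by field_simp; ring]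
    rw [show -2 / (n + 1 : ℝ) = ((2 : ℕ) : ℝ) * -(1 / (n + 1)) by push_cast; ring, Real.exp_nat_mul,
      Real.exp_neg]
    have h2 : (Real.exp (1 / (n + 1)))⁻¹ ≤ (n + 1 : ℝ) / (n + 2) := by
      rw [← inv_div (n + 2 : ℝ)]
      exact inv_anti₀ (by positivity) h1
    exact pow_le_pow_left₀ (by positivity) h2 2
  have key : ∀ᶠ N in atTop, ∀ n : ℕ, ‖T N (n + 1)‖ ≤ ‖ρ N 0‖ * (4 / (n + 2) ^ 2) := by
    filter_upwards [hρ 2] with N hN n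
    induction n with
    | zero => rw [hT, h0]; norm_num
    | succ n ih =>
      rw [hT, norm_mul]
      have hb : ‖ρ N (n + 1)‖ ≤ ((n + 2 : ℝ) / (n + 3)) ^ 2 := by
        refine (hN (n + 1)).trans ((hexp (n + 1)).trans_eq ?_)
        push_cast
        ring
      calc ‖T N (n + 1)‖ * ‖ρ N (n + 1)‖
          ≤ (‖ρ N 0‖ * (4 / (n + 2) ^ 2)) * ((n + 2 : ℝ) / (n + 3)) ^ 2 := by gcongr
        _ = ‖ρ N 0‖ * (4 / (((n + 1 : ℕ) : ℝ) + 2) ^ 2) := by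
          push_cast
          field_simp
          ring
  have hsum : Summable fun n : ℕ => (4 : ℝ) / (n + 2) ^ 2 := by
    have := (summable_nat_add_iff 2).mpr (Real.summable_one_div_nat_pow.mpr one_lt_two)
    simpa [div_eq_mul_inv] using this.mul_left 4
  have hlim : Tendsto (fun N => ∑' n, T N (n + 1)) atTop (𝓝 0) := by
    refine squeeze_zero_norm' ?_ (a := fun N => ‖ρ N 0‖ * ∑' n : ℕ, (4 : ℝ) / (n + 2) ^ 2) ?_
    · filter_upwards [key] with N hN
      exact tsum_of_norm_bounded (hsum.hasSum.mul_left _) hN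
    · simpa using hρ0.norm.mul_const (∑' n : ℕ, (4 : ℝ) / (n + 2) ^ 2)
  have h2 : Tendsto (fun N => 1 + ∑' n, T N (n + 1)) atTop (𝓝 1) := by
    simpa using hlim.const_add 1
  refine h2.congr' ?_
  filter_upwards [key] with N hN
  have hs : Summable (T N) := (summable_nat_add_iff 1).mp
    (Summable.of_norm_bounded (hsum.mul_left _) hN)
  rw [hs.tsum_eq_zero_add, h0]

/-- Summation by shifting a parameter: if `T N` and `r N • T (N + 1)` differ by a telescoping
sequence for every `N`, the sums of the `T N` tend to `1` and the product of the `r N` converges,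
then that product is the sum of `T 0`. -/
lemma tsum_eq_of_telescoping (T G : ℕ → ℕ → ℂ) (r : ℕ → ℂ) {L : ℂ}
    (hT : ∀ N, Summable (T N))
    (hG : ∀ N n, T N n - r N * T (N + 1) n = G N (n + 1) - G N n)
    (hG0 : ∀ N, G N 0 = 0) (hG1 : ∀ N, Tendsto (G N) atTop (𝓝 0))
    (hone : Tendsto (fun N => ∑' n, T N n) atTop (𝓝 1))
    (hr : Tendsto (fun N => ∏ j ∈ Finset.range N, r j) atTop (𝓝 L)) :
    ∑' n, T 0 n = L := by
  have step : ∀ N, ∑' n, T N n = r N * ∑' n, T (N + 1) n := by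
    intro N
    have h1 : HasSum (fun n => T N n - r N * T (N + 1) n)
        (∑' n, T N n - r N * ∑' n, T (N + 1) n) :=
      (hT N).hasSum.sub ((hT (N + 1)).hasSum.mul_left _)
    have h2 := h1.tendsto_sum_nat
    simp_rw [hG, Finset.sum_range_sub, hG0, sub_zero] at h2
    exact sub_eq_zero.mp (tendsto_nhds_unique h2 (hG1 N))
  have iter : ∀ N, ∑' n, T 0 n = (∏ j ∈ Finset.range N, r j) * ∑' n, T N n := by
    intro N
    induction N with
    | zero => simp
    | succ N ih => rw [ih, step N, Finset.prod_range_succ, mul_assoc]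
  have h := hr.mul hone
  simp_rw [← iter, mul_one] at h
  exact tendsto_nhds_unique tendsto_const_nhds h

/-! ### Uniform bounds for quotients of linear factors -/

lemma norm_add_natCast_div_one_add_le (x : ℂ) (n : ℕ) :
    ‖(x + n) / (1 + n)‖ ≤ Real.exp (‖x - 1‖ / (n + 1)) := by
  have hn : (0 : ℝ) < n + 1 := by positivity
  have h1 : ‖(1 + n : ℂ)‖ = n + 1 := by
    rw [show (1 + n : ℂ) = ((n + 1 : ℕ) : ℂ) by push_cast; ring, Complex.norm_natCast]
    push_cast
    ring
  refine le_trans ?_ (Real.add_one_le_exp _)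
  rw [norm_div, h1, div_le_iff₀ hn, add_mul, div_mul_cancel₀ _ hn.ne', one_mul]
  calc ‖x + n‖ = ‖(x - 1) + (1 + n)‖ := by ring_nf
    _ ≤ ‖x - 1‖ + (n + 1) := (norm_add_le _ _).trans_eq (by rw [h1])

lemma natCast_sub_le_norm_add (y : ℂ) (n : ℕ) : (n : ℝ) - ‖y‖ ≤ ‖y + n‖ := by
  have := norm_sub_norm_le (n : ℂ) (-y)
  rwa [norm_neg, Complex.norm_natCast, sub_neg_eq_add, add_comm (n : ℂ)] at this

/-- If a denominator shifted by `N` exceeds `n + 1`, replacing it by a nearby number costs a factor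
`1 + O(1 / (n + 1))`, uniformly in `N`. -/
lemma eventually_norm_shift_div_shift_le (x y : ℂ) :
    ∀ᶠ N : ℕ in atTop, ∀ n : ℕ,
      ‖(x + N + n) / (y + N + n)‖ ≤ Real.exp (‖x - y‖ / (n + 1)) := by
  filter_upwards [eventually_ge_atTop (⌈‖y‖⌉₊ + 1)] with N hN n
  have hN' : ‖y‖ + 1 ≤ N := by
    have := Nat.le_ceil ‖y‖
    have h2 : ((⌈‖y‖⌉₊ + 1 : ℕ) : ℝ) ≤ N := by exact_mod_cast hN
    push_cast at h2
    linarith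
  have hn : (0 : ℝ) < n + 1 := by positivity
  have h1 : (n + 1 : ℝ) ≤ ‖y + N + n‖ := by
    have := natCast_sub_le_norm_add y (N + n)
    push_cast at this
    rw [← add_assoc] at this
    linarith
  have h0 : 0 < ‖y + N + n‖ := by linarith
  refine le_trans ?_ (Real.add_one_le_exp _)
  rw [norm_div, div_le_iff₀ h0, add_mul, one_mul]
  calc ‖x + N + n‖ = ‖(x - y) + (y + N + n)‖ := by ring_nf
    _ ≤ ‖x - y‖ + ‖y + N + n‖ := norm_add_le _ _
    _ ≤ ‖x - y‖ / (n + 1) * ‖y + N + n‖ + ‖y + N + n‖ := by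
      gcongr
      rw [div_mul_eq_mul_div, le_div_iff₀ hn]
      gcongr

/-- A linear factor divided by one shifted by `N` eventually beats any given `exp (-K / (n + 1))`,
uniformly in `n`. -/
lemma eventually_norm_div_shift_le (x y : ℂ) (K : ℝ) :
    ∀ᶠ N : ℕ in atTop, ∀ n : ℕ,
      ‖(x + n) / (y + N + n)‖ ≤ Real.exp (-K / (n + 1)) := by
  set M : ℝ := ‖x‖ + 1 with hM
  have hM1 : 1 ≤ M := by have := norm_nonneg x; linarith
  filter_upwards [eventually_ge_atTop ⌈M * Real.exp |K| + M + ‖y‖⌉₊] with N hN n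
  have hN' : M * Real.exp |K| + M + ‖y‖ ≤ N := Nat.ceil_le.mp hN
  have hn : (0 : ℝ) < n + 1 := by positivity
  have hn1 : (1 : ℝ) ≤ n + 1 := by have : (0 : ℝ) ≤ n := n.cast_nonneg; linarith
  have hn0 : (0 : ℝ) ≤ n := n.cast_nonneg
  have h1 : n + M + M * Real.exp |K| ≤ ‖y + N + n‖ := by
    have := natCast_sub_le_norm_add y (N + n)
    push_cast at this
    rw [← add_assoc] at this
    linarith
  have h2 : ‖x + n‖ ≤ n + M := by
    refine (norm_add_le _ _).trans ?_
    rw [Complex.norm_natCast]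
    linarith
  -- convexity of the exponential on `[0, |K|]`
  have h3 : Real.exp (|K| / (n + 1)) ≤ 1 + Real.exp |K| / (n + 1) := by
    have hc := convexOn_exp.2 (Set.mem_univ (0 : ℝ)) (Set.mem_univ |K|)
      (show 0 ≤ 1 - 1 / (n + 1 : ℝ) by rw [sub_nonneg, div_le_one hn]; exact hn1)
      (show 0 ≤ 1 / (n + 1 : ℝ) by positivity) (by ring)
    simp only [smul_eq_mul, mul_zero, zero_add, Real.exp_zero, mul_one] at hc
    rw [one_div_mul_eq_div, one_div_mul_eq_div] at hc
    have : (0 : ℝ) ≤ 1 / (n + 1) := by positivity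
    linarith
  have h4 : (n + M) * Real.exp (|K| / (n + 1)) ≤ ‖y + N + n‖ := by
    refine le_trans ?_ h1
    calc (n + M) * Real.exp (|K| / (n + 1)) ≤ (n + M) * (1 + Real.exp |K| / (n + 1)) := by gcongr
      _ = n + M + (n + M) / (n + 1) * Real.exp |K| := by ring
      _ ≤ n + M + M * Real.exp |K| := by
        gcongr
        rw [div_le_iff₀ hn]
        nlinarith
  have h5 : Real.exp (-|K| / (n + 1)) ≤ Real.exp (-K / (n + 1)) := by
    gcongr
    exact le_abs_self K
  refine le_trans ?_ h5
  have h0 : 0 < ‖y + N + n‖ := by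
    have : 0 < M * Real.exp |K| := by positivity
    linarith
  rw [norm_div, div_le_iff₀ h0, neg_div, Real.exp_neg, ← div_eq_inv_mul,
    le_div_iff₀ (Real.exp_pos _)]
  exact (mul_le_mul_of_nonneg_right h2 (Real.exp_pos _).le).trans h4

/-! ### Very-well-poised terms -/

/-- The quotient of consecutive very-well-poised weights `a + 2 n`, for `a` shifted by `N`. -/
lemma eventually_norm_wellPoised_weight_le (a : ℂ) :
    ∀ᶠ N : ℕ in atTop, ∀ n : ℕ,
      ‖(1 + (a + N) / 2 + n) / ((a + N) / 2 + n)‖ ≤ Real.exp (2 / (n + 1)) := by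
  filter_upwards [eventually_norm_shift_div_shift_le (2 + a) a] with N hN n
  have h : (1 + (a + N) / 2 + n) / ((a + N) / 2 + n) =
      (2 + a + N + ((2 * n : ℕ) : ℂ)) / (a + N + ((2 * n : ℕ) : ℂ)) := by
    rw [show 2 + a + N + ((2 * n : ℕ) : ℂ) = 2 * (1 + (a + N) / 2 + n) by push_cast; ring,
      show a + N + ((2 * n : ℕ) : ℂ) = 2 * ((a + N) / 2 + n) by push_cast; ring,
      mul_div_mul_left _ _ two_ne_zero]
  rw [h]
  refine (hN (2 * n)).trans ?_
  rw [add_sub_cancel_right]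
  have hn0 : (0 : ℝ) ≤ n := n.cast_nonneg
  simp only [Complex.norm_ofNat]
  gcongr
  linarith

lemma risingFactorial_wellPoised_weight {a : ℂ} (ha : ∀ n : ℕ, a + n ≠ 0) (n : ℕ) :
    risingFactorial (1 + a / 2) n / risingFactorial (a / 2) n = (a + 2 * n) / a := by
  rw [risingFactorial_one_add_div (half_add_natCast_ne_zero ha),
    ← mul_div_mul_left _ (a / 2) (two_ne_zero (α := ℂ))]
  congr 1 <;> ring

lemma wellPoised_weight_succ (a : ℂ) (n : ℕ) :
    (1 + a / 2 + n) / (a / 2 + n) = (a + 2 * (n + 1)) / (a + 2 * n) := by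
  rw [← mul_div_mul_left _ (a / 2 + n) (two_ne_zero (α := ℂ))]
  congr 1 <;> ring

/-! ### The very-well-poised `₅F₄` sum at `1` -/

/-- The terms of the very-well-poised series `₅F₄(a; b, c, d; 1)`. The lower parameter `1` supplies
the factorial. -/
noncomputable def wellPoisedTerm54 (a b c d : ℂ) : ℕ → ℂ :=
  hypergeometricTerm ![a, 1 + a / 2, b, c, d] ![1, a / 2, 1 + a - b, 1 + a - c, 1 + a - d] 1

lemma wellPoisedTerm54_eq {a b c d : ℂ} (ha : ∀ n : ℕ, a + n ≠ 0) (n : ℕ) :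
    wellPoisedTerm54 a b c d n = (a + 2 * n) / a *
      (risingFactorial a n * risingFactorial b n * risingFactorial c n * risingFactorial d n /
        (risingFactorial 1 n * risingFactorial (1 + a - b) n * risingFactorial (1 + a - c) n *
          risingFactorial (1 + a - d) n)) := by
  rw [← risingFactorial_wellPoised_weight ha]
  simp only [wellPoisedTerm54, hypergeometricTerm, Fin.prod_univ_five, Matrix.cons_val, one_pow]
  ring

lemma wellPoisedTerm54_shift {a b c d : ℂ} (ha : ∀ n : ℕ, a + n ≠ 0)
    (hb : ∀ n : ℕ, 1 + a - b + n ≠ 0) (hc : ∀ n : ℕ, 1 + a - c + n ≠ 0)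
    (hd : ∀ n : ℕ, 1 + a - d + n ≠ 0) (n : ℕ) :
    wellPoisedTerm54 (a + 1) b c d n = wellPoisedTerm54 a b c d n *
      ((a + n) * (a + 1 + 2 * n) / ((a + 1) * (a + 2 * n)) *
        ((1 + a - b) * (1 + a - c) * (1 + a - d) /
          ((1 + a - b + n) * (1 + a - c + n) * (1 + a - d + n)))) := by
  have ha' : ∀ n : ℕ, a + 1 + n ≠ 0 := by simpa using add_natCast_add_natCast_ne_zero ha 1
  have ha0 : a ≠ 0 := by simpa using ha 0
  have ha2 : a + 2 * n ≠ 0 := by simpa using ha (2 * n)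
  have hA : risingFactorial (a + 1) n = risingFactorial a n * (a + n) / a :=
    eq_div_of_mul_eq ha0 ((mul_comm _ _).trans (mul_risingFactorial_add_one a n))
  rw [wellPoisedTerm54_eq ha, wellPoisedTerm54_eq ha', hA,
    show 1 + (a + 1) - b = 1 + a - b + 1 by ring, show 1 + (a + 1) - c = 1 + a - c + 1 by ring,
    show 1 + (a + 1) - d = 1 + a - d + 1 by ring]
  simp only [div_eq_mul_inv, mul_inv]
  rw [inv_risingFactorial_add_one hb, inv_risingFactorial_add_one hc,
    inv_risingFactorial_add_one hd]
  generalize 1 + a - b + n = B', 1 + a - c + n = C', 1 + a - d + n = D'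
  generalize 1 + a - b = B, 1 + a - c = C, 1 + a - d = D
  generalize a + 1 + 2 * n = w', a + 2 * n = w at ha2 ⊢
  rw [mul_comm w a⁻¹]
  have h : w * w⁻¹ = 1 := mul_inv_cancel₀ ha2
  generalize w⁻¹ = v at h ⊢
  generalize (a + 1)⁻¹ = u
  linear_combination (-w' * u * a⁻¹ * risingFactorial a n * (a + n) * risingFactorial b n *
    risingFactorial c n * risingFactorial d n * (risingFactorial 1 n)⁻¹ * (risingFactorial B n)⁻¹ *
    (risingFactorial C n)⁻¹ * (risingFactorial D n)⁻¹ * B * C * D * B'⁻¹ * C'⁻¹ * D'⁻¹) * h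

lemma wellPoisedTerm54_succ (a b c d : ℂ) (n : ℕ) :
    wellPoisedTerm54 a b c d (n + 1) = wellPoisedTerm54 a b c d n *
      ((a + n) * (b + n) * (c + n) * (d + n) * (a + 2 * (n + 1)) /
        ((n + 1) * (a + 2 * n) * (1 + a - b + n) * (1 + a - c + n) * (1 + a - d + n))) := by
  simp only [wellPoisedTerm54]
  rw [hypergeometricTerm_succ]
  congr 1
  simp only [Fin.prod_univ_five, Matrix.cons_val, mul_one]
  have h := wellPoised_weight_succ a n
  rw [add_comm (1 : ℂ) (n : ℂ)]
  generalize 1 + a - b + n = B', 1 + a - c + n = C', 1 + a - d + n = D'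
  generalize a + 2 * (n + 1) = w', a + 2 * n = w, 1 + a / 2 + n = u', a / 2 + n = u at h ⊢
  calc (a + n) * u' * (b + n) * (c + n) * (d + n) / ((n + 1) * u * B' * C' * D')
      = u' / u * ((a + n) * (b + n) * (c + n) * (d + n) / ((n + 1) * B' * C' * D')) := by
        generalize (n : ℂ) + 1 = k
        ring
    _ = _ := by
        rw [h]
        generalize (n : ℂ) + 1 = k
        ring

/-- The telescoping certificate for the shift `a ↦ a + 1`. The multiplier of the shifted term is the
quotient of the closed forms of the sums at `a` and `a + 1`. -/
lemma wellPoisedTerm54_telescope {a b c d : ℂ} (ha : ∀ n : ℕ, a + n ≠ 0)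
    (hb : ∀ n : ℕ, 1 + a - b + n ≠ 0) (hc : ∀ n : ℕ, 1 + a - c + n ≠ 0)
    (hd : ∀ n : ℕ, 1 + a - d + n ≠ 0) (hs : 1 + a - b - c - d ≠ 0) (n : ℕ) :
    wellPoisedTerm54 a b c d n -
      ((a + 1) * (1 + a - b - c) * (1 + a - b - d) * (1 + a - c - d)) /
        ((1 + a - b) * (1 + a - c) * (1 + a - d) * (1 + a - b - c - d)) *
        wellPoisedTerm54 (a + 1) b c d n =
    -(((n + 1 : ℕ) : ℂ) * wellPoisedTerm54 a b c d (n + 1) *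
        ((((n + 1 : ℕ) : ℂ) + a + (1 + a - b - c - d)) /
          ((a + 2 * ((n + 1 : ℕ) : ℂ)) * (1 + a - b - c - d)))) -
      -((n : ℂ) * wellPoisedTerm54 a b c d n *
        ((n + a + (1 + a - b - c - d)) / ((a + 2 * n) * (1 + a - b - c - d)))) := by
  have ha1 : a + 1 ≠ 0 := by simpa using ha 1
  have ha2 : a + 2 * n ≠ 0 := by simpa using ha (2 * n)
  have ha3 : a + 2 * (n + 1) ≠ 0 := by simpa using ha (2 * (n + 1))
  have hb0 : 1 + a - b ≠ 0 := by simpa using hb 0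
  have hc0 : 1 + a - c ≠ 0 := by simpa using hc 0
  have hd0 : 1 + a - d ≠ 0 := by simpa using hd 0
  have hn : (n + 1 : ℂ) ≠ 0 := by exact_mod_cast n.succ_ne_zero
  -- the identity with denominators cleared; afterwards all factors are made opaque so that only
  -- this polynomial identity is expanded
  have hpoly : (a + 2 * n) * (1 + a - b + n) * (1 + a - c + n) * (1 + a - d + n) *
        (1 + a - b - c - d) -
      (a + n) * (a + 1 + 2 * n) * (1 + a - b - c) * (1 + a - b - d) * (1 + a - c - d) =
      -((a + n) * (b + n) * (c + n) * (d + n) * (n + 1 + a + (1 + a - b - c - d))) +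
        n * (n + a + (1 + a - b - c - d)) *
          (1 + a - b + n) * (1 + a - c + n) * (1 + a - d + n) := by
    ring
  rw [wellPoisedTerm54_shift ha hb hc hd, wellPoisedTerm54_succ]
  push_cast
  have hbn := hb n
  have hcn := hc n
  have hdn := hd n
  generalize wellPoisedTerm54 a b c d n = t
  generalize n + 1 + a + (1 + a - b - c - d) = Y', n + a + (1 + a - b - c - d) = Y at hpoly ⊢
  generalize 1 + a - b + n = B', 1 + a - c + n = C', 1 + a - d + n = D', 1 + a - b - c = X₁,
    1 + a - b - d = X₂, 1 + a - c - d = X₃ at *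
  generalize 1 + a - b = B, 1 + a - c = C, 1 + a - d = D at *
  generalize a + 1 + 2 * n = w₁, a + 2 * (n + 1) = w₂, a + 2 * n = w, a + n = m at *
  generalize a + 1 = p, (n : ℂ) + 1 = k at *
  field_simp
  linear_combination t * hpoly

lemma tendsto_affine_div_affine (x y z : ℂ) :
    Tendsto (fun n : ℕ => (n + x) / ((y + 2 * n) * z)) atTop (𝓝 (1 / (2 * z))) := by
  have h1 : Tendsto (fun n : ℕ => 1 + x * (n : ℂ)⁻¹) atTop (𝓝 (1 + x * 0)) :=
    ((tendsto_inv_atTop_nhds_zero_nat (𝕜 := ℂ)).const_mul x).const_add 1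
  have h2 : Tendsto (fun n : ℕ => y * (n : ℂ)⁻¹ + 2) atTop (𝓝 (y * 0 + 2)) :=
    ((tendsto_inv_atTop_nhds_zero_nat (𝕜 := ℂ)).const_mul y).add_const 2
  have h3 := (h1.div h2 (by simp)).mul_const z⁻¹
  rw [mul_zero, mul_zero, add_zero, zero_add, ← div_eq_mul_inv, div_div] at h3
  refine h3.congr' ?_
  filter_upwards [eventually_ne_atTop 0] with n hn
  have hn' : (n : ℂ) ≠ 0 := Nat.cast_ne_zero.mpr hn
  simp only [Pi.div_apply]
  rw [← div_eq_mul_inv _ z, div_div, ← mul_div_mul_left _ _ hn']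
  congr 1 <;> field_simp

lemma tendsto_tsum_wellPoisedTerm54 (a b c d : ℂ) :
    Tendsto (fun N : ℕ => ∑' n, wellPoisedTerm54 (a + N) b c d n) atTop (𝓝 1) := by
  refine tendsto_tsum_one_of_ratio (fun N : ℕ => wellPoisedTerm54 (a + N) b c d)
    (fun N n => (a + N + n) / (1 + a - b + N + n) * ((b + n) / (1 + n)) *
      ((1 + (a + N) / 2 + n) / ((a + N) / 2 + n)) *
      ((c + n) / (1 + a - c + N + n)) * ((d + n) / (1 + a - d + N + n)))
    (fun N => hypergeometricTerm_zero _ _ _) (fun N n => ?_) fun K => ?_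
  · simp only [wellPoisedTerm54]
    rw [hypergeometricTerm_succ]
    congr 1
    simp only [Fin.prod_univ_five, Matrix.cons_val, mul_one, mul_div_mul_comm]
    rw [show 1 + (a + N) - b = 1 + a - b + N by ring, show 1 + (a + N) - c = 1 + a - c + N by ring,
      show 1 + (a + N) - d = 1 + a - d + N by ring]
    simp only [div_eq_mul_inv _ (_ + _)]
    generalize (1 + a - b + N + (n : ℂ))⁻¹ = B
    generalize (1 + (n : ℂ))⁻¹ = k
    ring
  · -- one of the two factors that become small absorbs the constants of the other three
    filter_upwards [eventually_norm_shift_div_shift_le a (1 + a - b),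
      eventually_norm_wellPoised_weight_le a, eventually_norm_div_shift_le c (1 + a - c) 0,
      eventually_norm_div_shift_le d (1 + a - d) (‖a - (1 + a - b)‖ + ‖b - 1‖ + 2 + K)]
      with N h1 h2 h3 h4 n
    simp only [norm_mul]
    calc
      _ ≤ Real.exp (‖a - (1 + a - b)‖ / (n + 1)) * Real.exp (‖b - 1‖ / (n + 1)) *
          Real.exp (2 / (n + 1)) * Real.exp (-0 / (n + 1)) *
          Real.exp (-(‖a - (1 + a - b)‖ + ‖b - 1‖ + 2 + K) / (n + 1)) := by
        gcongr
        exacts [h1 n, norm_add_natCast_div_one_add_le b n, h2 n, h3 n, h4 n]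
      _ = Real.exp (-K / (n + 1)) := by
        simp only [← Real.exp_add]
        congr 1
        ring

/-- The sum of the very-well-poised series `₅F₄(a; b, c, d; 1)`. -/
theorem hasSum_wellPoisedTerm54 {a b c d : ℂ} (ha : ∀ n : ℕ, a + n ≠ 0)
    (hb : ∀ n : ℕ, 1 + a - b + n ≠ 0) (hc : ∀ n : ℕ, 1 + a - c + n ≠ 0)
    (hd : ∀ n : ℕ, 1 + a - d + n ≠ 0) (hs : 0 < (1 + a - b - c - d).re) :
    HasSum (wellPoisedTerm54 a b c d)
      (Complex.Gamma (1 + a - b) * Complex.Gamma (1 + a - c) * Complex.Gamma (1 + a - d) *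
          Complex.Gamma (1 + a - b - c - d) /
        (Complex.Gamma (a + 1) * Complex.Gamma (1 + a - b - c) * Complex.Gamma (1 + a - b - d) *
          Complex.Gamma (1 + a - c - d))) := by
  have shift : ∀ {x y : ℂ}, (∀ n : ℕ, x + n ≠ 0) → ∀ N : ℕ, x + N = y → ∀ n : ℕ, y + n ≠ 0 := by
    rintro x _ hx N rfl n
    exact add_natCast_add_natCast_ne_zero hx N n
  have haN : ∀ N n : ℕ, a + N + n ≠ 0 := fun N => shift ha N rfl
  have hbN : ∀ N n : ℕ, 1 + (a + N) - b + n ≠ 0 := fun N => shift hb N (by ring)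
  have hcN : ∀ N n : ℕ, 1 + (a + N) - c + n ≠ 0 := fun N => shift hc N (by ring)
  have hdN : ∀ N n : ℕ, 1 + (a + N) - d + n ≠ 0 := fun N => shift hd N (by ring)
  have hsN : ∀ N : ℕ, 0 < (1 + (a + N) - b - c - d).re := by
    intro N
    rw [show 1 + (a + N) - b - c - d = 1 + a - b - c - d + N by ring, Complex.add_re,
      Complex.natCast_re]
    positivity
  have hlow : ∀ N : ℕ, ∀ i, ∀ n : ℕ, (![1, (a + N) / 2, 1 + (a + N) - b, 1 + (a + N) - c,
      1 + (a + N) - d] : Fin 5 → ℂ) i + n ≠ 0 := by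
    intro N i n
    fin_cases i
    exacts [add_natCast_ne_zero_of_re_pos (by simp) n, half_add_natCast_ne_zero (haN N) n,
      hbN N n, hcN N n, hdN N n]
  have hexc : ∀ N : ℕ, 1 < (∑ i, (![1, (a + N) / 2, 1 + (a + N) - b, 1 + (a + N) - c,
      1 + (a + N) - d] : Fin 5 → ℂ) i -
      ∑ i, (![a + N, 1 + (a + N) / 2, b, c, d] : Fin 5 → ℂ) i).re := by
    intro N
    simp only [Fin.sum_univ_five, Matrix.cons_val]
    rw [show 1 + (a + N) / 2 + (1 + (a + N) - b) + (1 + (a + N) - c) + (1 + (a + N) - d) -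
      (a + N + (1 + (a + N) / 2) + b + c + d) =
      1 + ((2 : ℝ) : ℂ) * (1 + (a + N) - b - c - d) by push_cast; ring, Complex.add_re,
      Complex.one_re, Complex.re_ofReal_mul]
    linarith [hsN N]
  have hsum : ∀ N : ℕ, Summable (wellPoisedTerm54 (a + N) b c d) := fun N =>
    summable_hypergeometricTerm _ _ (hlow N) norm_one (hexc N)
  have hprod := tendsto_prod_range_div
    ![a + 1, 1 + a - b - c, 1 + a - b - d, 1 + a - c - d]
    ![1 + a - b, 1 + a - c, 1 + a - d, 1 + a - b - c - d]
    (by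
      intro i n
      fin_cases i
      exacts [hb n, hc n, hd n, add_natCast_ne_zero_of_re_pos hs n])
    (by simp only [Fin.sum_univ_four, Matrix.cons_val]; ring)
  simp only [Fin.prod_univ_four, Matrix.cons_val] at hprod
  have key := tsum_eq_of_telescoping (fun N : ℕ => wellPoisedTerm54 (a + N) b c d)
    (fun N n => -((n : ℂ) * wellPoisedTerm54 (a + N) b c d n *
        ((n + (a + N) + (1 + (a + N) - b - c - d)) /
          ((a + N + 2 * n) * (1 + (a + N) - b - c - d)))))
    _ hsum (fun N n => ?_) (fun N => by simp) (fun N => ?_)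
    (tendsto_tsum_wellPoisedTerm54 a b c d) hprod
  · rw [← key]
    simpa using (hsum 0).hasSum
  · have hs0 : 1 + (a + N) - b - c - d ≠ 0 := by
      simpa using add_natCast_ne_zero_of_re_pos (hsN N) 0
    rw [← wellPoisedTerm54_telescope (haN N) (hbN N) (hcN N) (hdN N) hs0 n]
    rw [show a + N + 1 = a + (N + 1 : ℕ) by push_cast; ring]
    congr 3 <;> push_cast <;> ring
  · have h1 := tendsto_natCast_mul_hypergeometricTerm _ _ (hlow N) norm_one (hexc N)
    have h2 := tendsto_affine_div_affine
      (a + N + (1 + (a + N) - b - c - d)) (a + N) (1 + (a + N) - b - c - d)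
    have h3 := (h1.mul h2).neg
    rw [zero_mul, neg_zero] at h3
    refine h3.congr fun n => ?_
    rw [wellPoisedTerm54, ← add_assoc (n : ℂ)]

/-! ### A very-well-poised `₆F₅` sum at `-1` -/

/-- The terms of the very-well-poised series `₆F₅(a; b, 1 - b, d, 1 - d; -1)`. The lower parameter
`1` supplies the factorial. -/
noncomputable def wellPoisedTerm65 (a b d : ℂ) : ℕ → ℂ :=
  hypergeometricTerm ![a, 1 + a / 2, b, 1 - b, d, 1 - d]
    ![1, a / 2, 1 + a - b, a + b, 1 + a - d, a + d] (-1)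

lemma wellPoisedTerm65_eq {a b d : ℂ} (ha : ∀ n : ℕ, a + n ≠ 0) (n : ℕ) :
    wellPoisedTerm65 a b d n = (a + 2 * n) / a *
      (risingFactorial a n * risingFactorial b n * risingFactorial (1 - b) n *
        risingFactorial d n * risingFactorial (1 - d) n /
        (risingFactorial 1 n * risingFactorial (1 + a - b) n * risingFactorial (a + b) n *
          risingFactorial (1 + a - d) n * risingFactorial (a + d) n)) * (-1) ^ n := by
  rw [← risingFactorial_wellPoised_weight ha]
  simp only [wellPoisedTerm65, hypergeometricTerm, Fin.prod_univ_six, Matrix.cons_val]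
  congr 1
  simp only [div_eq_mul_inv _ (_ * _), mul_inv]
  ring

lemma wellPoisedTerm65_shift {a b d : ℂ} (ha : ∀ n : ℕ, a + n ≠ 0)
    (hb : ∀ n : ℕ, 1 + a - b + n ≠ 0) (hb' : ∀ n : ℕ, a + b + n ≠ 0)
    (hd : ∀ n : ℕ, 1 + a - d + n ≠ 0) (hd' : ∀ n : ℕ, a + d + n ≠ 0) (n : ℕ) :
    wellPoisedTerm65 (a + 1) b d n = wellPoisedTerm65 a b d n *
      ((a + n) * (a + 1 + 2 * n) / ((a + 1) * (a + 2 * n)) *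
        ((1 + a - b) * (a + b) * (1 + a - d) * (a + d) /
          ((1 + a - b + n) * (a + b + n) * (1 + a - d + n) * (a + d + n)))) := by
  have ha' : ∀ n : ℕ, a + 1 + n ≠ 0 := by simpa using add_natCast_add_natCast_ne_zero ha 1
  have ha0 : a ≠ 0 := by simpa using ha 0
  have ha2 : a + 2 * n ≠ 0 := by simpa using ha (2 * n)
  have hA : risingFactorial (a + 1) n = risingFactorial a n * (a + n) / a :=
    eq_div_of_mul_eq ha0 ((mul_comm _ _).trans (mul_risingFactorial_add_one a n))
  rw [wellPoisedTerm65_eq ha, wellPoisedTerm65_eq ha', hA,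
    show 1 + (a + 1) - b = 1 + a - b + 1 by ring, show a + 1 + b = a + b + 1 by ring,
    show 1 + (a + 1) - d = 1 + a - d + 1 by ring, show a + 1 + d = a + d + 1 by ring]
  simp only [div_eq_mul_inv, mul_inv]
  rw [inv_risingFactorial_add_one hb, inv_risingFactorial_add_one hb',
    inv_risingFactorial_add_one hd, inv_risingFactorial_add_one hd']
  generalize 1 + a - b + n = B', 1 + a - d + n = D', a + b + n = C', a + d + n = E'
  generalize 1 + a - b = B, 1 + a - d = D, a + b = C, a + d = E
  generalize a + 1 + 2 * n = w', a + 2 * n = w at ha2 ⊢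
  rw [mul_comm w a⁻¹]
  have h : w * w⁻¹ = 1 := mul_inv_cancel₀ ha2
  generalize w⁻¹ = v at h ⊢
  generalize (a + 1)⁻¹ = u
  generalize (risingFactorial 1 n)⁻¹ = f, (risingFactorial B n)⁻¹ = fB,
    (risingFactorial C n)⁻¹ = fC, (risingFactorial D n)⁻¹ = fD, (risingFactorial E n)⁻¹ = fE,
    risingFactorial b n = gb, risingFactorial (1 - b) n = gb', risingFactorial d n = gd,
    risingFactorial (1 - d) n = gd', risingFactorial a n = ga, (-1 : ℂ) ^ n = e
  linear_combination (-w' * u * a⁻¹ * ga * (a + n) * gb * gb' * gd * gd' * f * fB * fC * fD * fE *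
    B * C * D * E * B'⁻¹ * C'⁻¹ * D'⁻¹ * E'⁻¹ * e) * h

lemma wellPoisedTerm65_succ (a b d : ℂ) (n : ℕ) :
    wellPoisedTerm65 a b d (n + 1) = -(wellPoisedTerm65 a b d n *
      ((a + n) * (b + n) * (1 - b + n) * (d + n) * (1 - d + n) * (a + 2 * (n + 1)) /
        ((n + 1) * (a + 2 * n) * (1 + a - b + n) * (a + b + n) * (1 + a - d + n) *
          (a + d + n)))) := by
  simp only [wellPoisedTerm65]
  rw [hypergeometricTerm_succ, ← mul_neg]
  congr 1
  simp only [Fin.prod_univ_six, Matrix.cons_val, mul_neg_one]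
  congr 1
  have h := wellPoised_weight_succ a n
  rw [add_comm (1 : ℂ) (n : ℂ)]
  generalize 1 + a - b + n = B', 1 + a - d + n = D', a + b + n = C', a + d + n = E',
    1 - b + (n : ℂ) = b', 1 - d + (n : ℂ) = d'
  generalize a + 2 * (n + 1) = w', a + 2 * n = w, 1 + a / 2 + n = u', a / 2 + n = u at h ⊢
  calc (a + n) * u' * (b + n) * b' * (d + n) * d' / ((n + 1) * u * B' * C' * D' * E')
      = u' / u * ((a + n) * (b + n) * b' * (d + n) * d' / ((n + 1) * B' * C' * D' * E')) := by
        generalize (n : ℂ) + 1 = k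
        ring
    _ = _ := by
        rw [h]
        generalize (n : ℂ) + 1 = k
        ring

/-- The numerator polynomial of the telescoping certificate for the shift `a ↦ a + 2` of
`wellPoisedTerm65`, where `p = b (1 - b)` and `q = d (1 - d)`. -/
noncomputable def wellPoisedCert (p q a n : ℂ) : ℂ :=
  n ^ 4 + 2 * n ^ 3 + n ^ 2 + 6 * a * n ^ 3 + 14 * a ^ 2 * n ^ 2 + 10 * a * n ^ 2 +
    15 * a ^ 3 * n + 17 * a ^ 2 * n + 4 * a * n + 6 * a ^ 4 + 9 * a ^ 3 + 3 * a ^ 2 +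
    (p + q) * (n ^ 2 + n + 3 * a * n + 2 * a ^ 2 + a) + p * q

/-- The telescoping certificate for the shift `a ↦ a + 2`. The multiplier of the shifted term is
written with halved factors because `a / 2` is what increases by `1`. -/
lemma wellPoisedTerm65_telescope {a b d : ℂ} (ha : ∀ n : ℕ, a + n ≠ 0)
    (hb : ∀ n : ℕ, 1 + a - b + n ≠ 0) (hb' : ∀ n : ℕ, a + b + n ≠ 0)
    (hd : ∀ n : ℕ, 1 + a - d + n ≠ 0) (hd' : ∀ n : ℕ, a + d + n ≠ 0) (n : ℕ) :
    wellPoisedTerm65 a b d n -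
      (a / 2 * ((a + 1) / 2) * ((a + 1) / 2) * ((a + 1 + 1) / 2) * ((1 + a - b + d) / 2) *
          ((2 + a - b - d) / 2) * ((a + b + d) / 2) * ((1 + a + b - d) / 2)) /
        ((1 + a - b) / 2 * ((1 + a - b + 1) / 2) * ((a + b) / 2) * ((a + b + 1) / 2) *
          ((1 + a - d) / 2) * ((1 + a - d + 1) / 2) * ((a + d) / 2) * ((a + d + 1) / 2)) *
        wellPoisedTerm65 (a + 1 + 1) b d n =
    -(((n + 1 : ℕ) : ℂ) * wellPoisedTerm65 a b d (n + 1) *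
        (wellPoisedCert (b * (1 - b)) (d * (1 - d)) a (n + 1 : ℕ) /
          ((a + 2 * ((n + 1 : ℕ) : ℂ)) * ((1 + a - b + (n + 1 : ℕ)) * (a + b + (n + 1 : ℕ)) *
            (1 + a - d + (n + 1 : ℕ)) * (a + d + (n + 1 : ℕ)))))) -
      -((n : ℂ) * wellPoisedTerm65 a b d n *
        (wellPoisedCert (b * (1 - b)) (d * (1 - d)) a n /
          ((a + 2 * n) * ((1 + a - b + n) * (a + b + n) * (1 + a - d + n) * (a + d + n))))) := by
  have succ : ∀ {x y : ℂ}, (∀ n : ℕ, x + n ≠ 0) → x + 1 = y → ∀ n : ℕ, y + n ≠ 0 := by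
    rintro x _ hx rfl n
    simpa using add_natCast_add_natCast_ne_zero hx 1 n
  have ha0 : a ≠ 0 := by simpa using ha 0
  have ha1 : a + 1 ≠ 0 := by simpa using ha 1
  have ha1' : a + 1 + 1 ≠ 0 := by simpa using succ ha rfl 1
  have ha2 : a + 2 * n ≠ 0 := by simpa using ha (2 * n)
  have ha2' : a + 1 + 2 * n ≠ 0 := by simpa using succ ha rfl (2 * n)
  have ha3 : a + 2 * (n + 1) ≠ 0 := by simpa using ha (2 * (n + 1))
  have hn : (n + 1 : ℂ) ≠ 0 := by exact_mod_cast n.succ_ne_zero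
  have hb0 : 1 + a - b ≠ 0 := by simpa using hb 0
  have hc0 : a + b ≠ 0 := by simpa using hb' 0
  have hd0 : 1 + a - d ≠ 0 := by simpa using hd 0
  have he0 : a + d ≠ 0 := by simpa using hd' 0
  have hb1 : 1 + a - b + 1 ≠ 0 := by simpa using hb 1
  have hc1 : a + b + 1 ≠ 0 := by simpa using hb' 1
  have hd1 : 1 + a - d + 1 ≠ 0 := by simpa using hd 1
  have he1 : a + d + 1 ≠ 0 := by simpa using hd' 1
  have hbn := hb n
  have hcn := hb' n
  have hdn := hd n
  have hen := hd' n
  have hbn' : 1 + a - b + (n + 1) ≠ 0 := by simpa using hb (n + 1)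
  have hcn' : a + b + (n + 1) ≠ 0 := by simpa using hb' (n + 1)
  have hdn' : 1 + a - d + (n + 1) ≠ 0 := by simpa using hd (n + 1)
  have hen' : a + d + (n + 1) ≠ 0 := by simpa using hd' (n + 1)
  -- the identity with denominators cleared, the only one in which the factors are expanded
  have hpoly : (a + 2 * n) * (1 + a - b + n) * (a + b + n) * (1 + a - d + n) * (a + d + n) *
        ((1 + a - b + (n + 1)) * (a + b + (n + 1)) * (1 + a - d + (n + 1)) * (a + d + (n + 1))) -
      a * (a + 1) * ((1 + a - b + d) * (2 + a - b - d) * (a + b + d) * (1 + a + b - d)) *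
        (a + n) * (a + 1 + n) * (a + 1 + 1 + 2 * n) =
      (a + n) * (b + n) * (1 - b + n) * (d + n) * (1 - d + n) *
        wellPoisedCert (b * (1 - b)) (d * (1 - d)) a (n + 1) +
      n * wellPoisedCert (b * (1 - b)) (d * (1 - d)) a n *
        ((1 + a - b + (n + 1)) * (a + b + (n + 1)) * (1 + a - d + (n + 1)) *
          (a + d + (n + 1))) := by
    simp only [wellPoisedCert]
    ring
  rw [wellPoisedTerm65_shift (succ ha rfl) (succ hb (by ring)) (succ hb' (by ring))
    (succ hd (by ring)) (succ hd' (by ring)), wellPoisedTerm65_shift ha hb hb' hd hd',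
    wellPoisedTerm65_succ]
  push_cast
  rw [show 1 + (a + 1) - b + n = 1 + a - b + (n + 1) by ring,
    show a + 1 + b + n = a + b + (n + 1) by ring,
    show 1 + (a + 1) - d + n = 1 + a - d + (n + 1) by ring,
    show a + 1 + d + n = a + d + (n + 1) by ring,
    show 1 + (a + 1) - b = 1 + a - b + 1 by ring, show a + 1 + b = a + b + 1 by ring,
    show 1 + (a + 1) - d = 1 + a - d + 1 by ring, show a + 1 + d = a + d + 1 by ring]
  generalize wellPoisedTerm65 a b d n = t
  generalize wellPoisedCert (b * (1 - b)) (d * (1 - d)) a (n + 1) = Y',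
    wellPoisedCert (b * (1 - b)) (d * (1 - d)) a n = Y at hpoly ⊢
  clear succ ha hb hb' hd hd'
  generalize 1 + a - b + (n + 1) = B₂, a + b + (n + 1) = C₂, 1 + a - d + (n + 1) = D₂,
    a + d + (n + 1) = E₂ at *
  generalize 1 + a - b + d = X₁, 2 + a - b - d = X₂, a + b + d = X₃, 1 + a + b - d = X₄ at *
  generalize 1 + a - b + n = B', a + b + n = C', 1 + a - d + n = D', a + d + n = E',
    1 - b + (n : ℂ) = b', 1 - d + (n : ℂ) = d' at *
  generalize 1 + a - b + 1 = B₁, a + b + 1 = C₁, 1 + a - d + 1 = D₁, a + d + 1 = E₁ at *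
  generalize 1 + a - b = B, a + b = C, 1 + a - d = D, a + d = E at *
  generalize a + 1 + 1 + 2 * n = w₂, a + 1 + 2 * n = w₁, a + 2 * (n + 1) = w₃, a + 2 * n = w,
    a + 1 + n = m₁, a + n = m, b + (n : ℂ) = b₀, d + (n : ℂ) = d₀ at *
  generalize a + 1 + 1 = p', a + 1 = p, (n : ℂ) + 1 = k at *
  field_simp
  linear_combination t * hpoly

lemma tendsto_tsum_wellPoisedTerm65 (a b d : ℂ) :
    Tendsto (fun N : ℕ => ∑' n, wellPoisedTerm65 (a + N) b d n) atTop (𝓝 1) := by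
  refine tendsto_tsum_one_of_ratio (fun N : ℕ => wellPoisedTerm65 (a + N) b d)
    (fun N n => -((a + N + n) / (1 + a - b + N + n) * ((b + n) / (1 + n)) *
      ((1 + (a + N) / 2 + n) / ((a + N) / 2 + n)) *
      ((1 - b + n) / (a + b + N + n)) * ((d + n) / (1 + a - d + N + n)) *
      ((1 - d + n) / (a + d + N + n))))
    (fun N => hypergeometricTerm_zero _ _ _) (fun N n => ?_) fun K => ?_
  · simp only [wellPoisedTerm65]
    rw [hypergeometricTerm_succ]
    congr 1
    simp only [Fin.prod_univ_six, Matrix.cons_val, mul_neg_one, mul_div_mul_comm]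
    rw [show 1 + (a + N) - b = 1 + a - b + N by ring, show a + N + b = a + b + N by ring,
      show 1 + (a + N) - d = 1 + a - d + N by ring, show a + N + d = a + d + N by ring]
    simp only [div_eq_mul_inv _ (_ + _)]
    generalize (1 + a - b + N + (n : ℂ))⁻¹ = B
    generalize (1 + (n : ℂ))⁻¹ = k
    ring
  · -- one of the three factors that become small absorbs the constants of the others
    filter_upwards [eventually_norm_shift_div_shift_le a (1 + a - b),
      eventually_norm_wellPoised_weight_le a, eventually_norm_div_shift_le (1 - b) (a + b) 0,
      eventually_norm_div_shift_le d (1 + a - d) 0,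
      eventually_norm_div_shift_le (1 - d) (a + d) (‖a - (1 + a - b)‖ + ‖b - 1‖ + 2 + K)]
      with N h1 h2 h3 h4 h5 n
    simp only [norm_mul, norm_neg]
    calc
      _ ≤ Real.exp (‖a - (1 + a - b)‖ / (n + 1)) * Real.exp (‖b - 1‖ / (n + 1)) *
          Real.exp (2 / (n + 1)) * Real.exp (-0 / (n + 1)) * Real.exp (-0 / (n + 1)) *
          Real.exp (-(‖a - (1 + a - b)‖ + ‖b - 1‖ + 2 + K) / (n + 1)) := by
        gcongr
        exacts [h1 n, norm_add_natCast_div_one_add_le b n, h2 n, h3 n, h4 n, h5 n]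
      _ = Real.exp (-K / (n + 1)) := by
        simp only [← Real.exp_add]
        congr 1
        ring

lemma tendsto_wellPoisedCert_div (p q a A B C D : ℂ) :
    Tendsto (fun n : ℕ => wellPoisedCert p q a n /
      ((a + 2 * n) * ((A + n) * (B + n) * (C + n) * (D + n)))) atTop (𝓝 0) := by
  -- the quotient is a rational function of `v = 1 / n` that is continuous and vanishes at `0`
  have hF : ContinuousAt (fun v : ℂ =>
      (1 + 2 * v + v ^ 2 + 6 * a * v + 14 * a ^ 2 * v ^ 2 + 10 * a * v ^ 2 +
        15 * a ^ 3 * v ^ 3 + 17 * a ^ 2 * v ^ 3 + 4 * a * v ^ 3 + 6 * a ^ 4 * v ^ 4 +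
        9 * a ^ 3 * v ^ 4 + 3 * a ^ 2 * v ^ 4 +
        (p + q) * (v ^ 2 + v ^ 3 + 3 * a * v ^ 3 + 2 * a ^ 2 * v ^ 4 + a * v ^ 4) +
        p * q * v ^ 4) * v /
      ((a * v + 2) * ((A * v + 1) * (B * v + 1) * (C * v + 1) * (D * v + 1)))) 0 := by
    refine ContinuousAt.div (by fun_prop) (by fun_prop) (by simp)
  have h := hF.tendsto.comp (tendsto_inv_atTop_nhds_zero_nat (𝕜 := ℂ))
  simp only [mul_zero, zero_div] at h
  refine h.congr' ?_
  filter_upwards [eventually_ne_atTop 0] with n hn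
  have hn' : (n : ℂ) ≠ 0 := Nat.cast_ne_zero.mpr hn
  simp only [Function.comp]
  rw [← mul_div_mul_left _ _ (pow_ne_zero 5 hn')]
  congr 1
  · simp only [wellPoisedCert]
    field_simp
  · have e : ∀ x : ℂ, x + n = n * (x * (n : ℂ)⁻¹ + 1) := fun x => by field_simp
    have e2 : a + 2 * n = n * (a * (n : ℂ)⁻¹ + 2) := by field_simp
    rw [e A, e B, e C, e D, e2]
    ring

/-- Legendre's duplication formula, with the argument halved. -/
lemma Gamma_half_mul_Gamma_add_one_half (x : ℂ) :
    Complex.Gamma (x / 2) * Complex.Gamma ((x + 1) / 2) =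
      Complex.Gamma x * 2 ^ (1 - x) * (Real.sqrt Real.pi : ℂ) := by
  have h := Complex.Gamma_mul_Gamma_add_half (x / 2)
  rw [mul_div_cancel₀ _ (two_ne_zero' ℂ)] at h
  rw [← h]
  congr 2
  ring

/-- The sum of the very-well-poised series `₆F₅(a; b, 1 - b, d, 1 - d; -1)`. -/
theorem hasSum_wellPoisedTerm65 {a b d : ℂ} (ha : 1 / 3 < a.re)
    (hb : ∀ n : ℕ, 1 + a - b + n ≠ 0) (hb' : ∀ n : ℕ, a + b + n ≠ 0)
    (hd : ∀ n : ℕ, 1 + a - d + n ≠ 0) (hd' : ∀ n : ℕ, a + d + n ≠ 0) :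
    HasSum (wellPoisedTerm65 a b d)
      (2 ^ (1 - 2 * a) * (Real.pi : ℂ) *
        (Complex.Gamma (1 + a - b) * Complex.Gamma (a + b) * Complex.Gamma (1 + a - d) *
          Complex.Gamma (a + d)) /
        (Complex.Gamma a * Complex.Gamma (a + 1) *
          (Complex.Gamma ((1 + a - b + d) / 2) * Complex.Gamma ((2 + a - b - d) / 2) *
          Complex.Gamma ((a + b + d) / 2) * Complex.Gamma ((1 + a + b - d) / 2)))) := by
  have shift : ∀ {x y : ℂ}, (∀ n : ℕ, x + n ≠ 0) → ∀ N : ℕ, x + N = y → ∀ n : ℕ, y + n ≠ 0 := by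
    rintro x _ hx N rfl n
    exact add_natCast_add_natCast_ne_zero hx N n
  have ha' : ∀ n : ℕ, a + n ≠ 0 := add_natCast_ne_zero_of_re_pos (by linarith)
  have haN : ∀ N n : ℕ, a + N + n ≠ 0 := fun N => shift ha' N rfl
  have hbN : ∀ N n : ℕ, 1 + (a + N) - b + n ≠ 0 := fun N => shift hb N (by ring)
  have hbN' : ∀ N n : ℕ, a + N + b + n ≠ 0 := fun N => shift hb' N (by ring)
  have hdN : ∀ N n : ℕ, 1 + (a + N) - d + n ≠ 0 := fun N => shift hd N (by ring)
  have hdN' : ∀ N n : ℕ, a + N + d + n ≠ 0 := fun N => shift hd' N (by ring)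
  have hlow : ∀ N : ℕ, ∀ i, ∀ n : ℕ, (![1, (a + N) / 2, 1 + (a + N) - b, a + N + b,
      1 + (a + N) - d, a + N + d] : Fin 6 → ℂ) i + n ≠ 0 := by
    intro N i n
    fin_cases i
    exacts [add_natCast_ne_zero_of_re_pos (by simp) n, half_add_natCast_ne_zero (haN N) n,
      hbN N n, hbN' N n, hdN N n, hdN' N n]
  have hexc : ∀ N : ℕ, 1 < (∑ i, (![1, (a + N) / 2, 1 + (a + N) - b, a + N + b,
      1 + (a + N) - d, a + N + d] : Fin 6 → ℂ) i -
      ∑ i, (![a + N, 1 + (a + N) / 2, b, 1 - b, d, 1 - d] : Fin 6 → ℂ) i).re := by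
    intro N
    simp only [Fin.sum_univ_six, Matrix.cons_val]
    rw [show 1 + (a + N) / 2 + (1 + (a + N) - b) + (a + N + b) + (1 + (a + N) - d) +
      (a + N + d) - (a + N + (1 + (a + N) / 2) + b + (1 - b) + d + (1 - d)) =
      ((3 : ℝ) : ℂ) * (a + N) by push_cast; ring, Complex.re_ofReal_mul, Complex.add_re,
      Complex.natCast_re]
    have : (0 : ℝ) ≤ N := N.cast_nonneg
    linarith
  have hsum : ∀ N : ℕ, Summable (wellPoisedTerm65 (a + N) b d) := fun N =>
    summable_hypergeometricTerm _ _ (hlow N) (by simp) (hexc N)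
  have hprod := tendsto_prod_range_div
    ![a / 2, (a + 1) / 2, (a + 1) / 2, (a + 1 + 1) / 2, (1 + a - b + d) / 2, (2 + a - b - d) / 2,
      (a + b + d) / 2, (1 + a + b - d) / 2]
    ![(1 + a - b) / 2, (1 + a - b + 1) / 2, (a + b) / 2, (a + b + 1) / 2,
      (1 + a - d) / 2, (1 + a - d + 1) / 2, (a + d) / 2, (a + d + 1) / 2]
    (by
      intro i n
      fin_cases i
      exacts [half_add_natCast_ne_zero hb n, add_one_half_add_natCast_ne_zero hb n,
        half_add_natCast_ne_zero hb' n, add_one_half_add_natCast_ne_zero hb' n,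
        half_add_natCast_ne_zero hd n, add_one_half_add_natCast_ne_zero hd n,
        half_add_natCast_ne_zero hd' n, add_one_half_add_natCast_ne_zero hd' n])
    (by simp only [Fin.sum_univ_eight, Matrix.cons_val]; ring)
  simp only [Fin.prod_univ_eight, Matrix.cons_val] at hprod
  have key := tsum_eq_of_telescoping (fun N : ℕ => wellPoisedTerm65 (a + (2 * N : ℕ)) b d)
    (fun N n => -((n : ℂ) * wellPoisedTerm65 (a + (2 * N : ℕ)) b d n *
        (wellPoisedCert (b * (1 - b)) (d * (1 - d)) (a + (2 * N : ℕ)) n /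
          ((a + (2 * N : ℕ) + 2 * n) * ((1 + (a + (2 * N : ℕ)) - b + n) *
            (a + (2 * N : ℕ) + b + n) * (1 + (a + (2 * N : ℕ)) - d + n) *
            (a + (2 * N : ℕ) + d + n))))))
    _ (fun N => hsum (2 * N)) (fun N n => ?_) (fun N => by simp) (fun N => ?_)
    ((tendsto_tsum_wellPoisedTerm65 a b d).comp (tendsto_id.const_mul_atTop' two_pos)) hprod
  · have hs := (hsum 0).hasSum
    simp only [Nat.cast_zero, add_zero, mul_zero] at hs key
    rw [key] at hs
    convert hs using 1
    have e : ∀ x y z w u v s t : ℂ, x * y * z * w * u * v * s * t =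
      (x * y) * (z * w) * (u * v) * (s * t) := fun x y z w u v s t => by ring
    have hpi : (Real.sqrt Real.pi : ℂ) ^ 2 = Real.pi := by
      rw [← Complex.ofReal_pow, Real.sq_sqrt Real.pi_pos.le]
    have hpi0 : (Real.sqrt Real.pi : ℂ) ≠ 0 := by
      rw [Complex.ofReal_ne_zero]
      exact (Real.sqrt_pos.mpr Real.pi_pos).ne'
    have h2 : ∀ x : ℂ, (2 : ℂ) ^ x ≠ 0 := fun x => by simp [Complex.cpow_eq_zero_iff]
    have hpow : (2 : ℂ) ^ (1 - (1 + a - b)) * 2 ^ (1 - (a + b)) * 2 ^ (1 - (1 + a - d)) *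
        2 ^ (1 - (a + d)) = 2 ^ (1 - 2 * a) * (2 ^ (1 - a) * 2 ^ (1 - (a + 1))) := by
      simp only [← Complex.cpow_add _ _ (two_ne_zero' ℂ)]
      congr 1
      ring
    rw [e (Complex.Gamma (a / 2)), e (Complex.Gamma ((1 + a - b) / 2))]
    simp only [Gamma_half_mul_Gamma_add_one_half]
    have hs0 : (2 : ℂ) ^ (1 - a) * 2 ^ (1 - (a + 1)) * (Real.sqrt Real.pi : ℂ) ^ 2 ≠ 0 :=
      mul_ne_zero (mul_ne_zero (h2 _) (h2 _)) (pow_ne_zero 2 hpi0)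
    rw [← mul_div_mul_left _ _ hs0, ← hpi]
    congr 1
    · linear_combination (-((Real.sqrt Real.pi : ℂ) ^ 4 * (Complex.Gamma (1 + a - b) *
        Complex.Gamma (a + b) * Complex.Gamma (1 + a - d) * Complex.Gamma (a + d)))) * hpow
    · ring
  · rw [← wellPoisedTerm65_telescope (haN _) (hbN _) (hbN' _) (hdN _) (hdN' _) n]
    rw [show a + (2 * N : ℕ) + 1 + 1 = a + (2 * (N + 1) : ℕ) by push_cast; ring]
    congr 3 <;> push_cast <;> ring
  · have h1 := tendsto_natCast_mul_hypergeometricTerm _ _ (hlow (2 * N)) (z := -1) (by simp)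
      (hexc (2 * N))
    have h2 := tendsto_wellPoisedCert_div (b * (1 - b)) (d * (1 - d)) (a + (2 * N : ℕ))
      (1 + (a + (2 * N : ℕ)) - b) (a + (2 * N : ℕ) + b) (1 + (a + (2 * N : ℕ)) - d)
      (a + (2 * N : ℕ) + d)
    have h3 := (h1.mul h2).neg
    rw [zero_mul, neg_zero] at h3
    exact h3

/-! ### The specialization -/

lemma HasSum.even_part {u : ℕ → ℂ} {A B : ℂ} (hA : HasSum u A)
    (hB : HasSum (fun n => (-1) ^ n * u n) B) :
    HasSum (fun k => u (2 * k)) ((A + B) / 2) := by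
  have h := (hA.add hB).div_const 2
  have hinj : Function.Injective fun k : ℕ => 2 * k := fun _ _ h => by simpa using h
  rw [← hinj.hasSum_iff] at h
  · refine h.congr_fun fun k => ?_
    simp
  · intro n hn
    have hodd : Odd n := by
      rw [← Nat.not_even_iff_odd]
      rintro ⟨k, rfl⟩
      exact hn ⟨k, by simp [two_mul]⟩
    simp [hodd.neg_one_pow]

/-- The common value of the `n`-th terms, up to sign, of the specializations of
`wellPoisedTerm54` and `wellPoisedTerm65` to `a = 1 / 2` and `d = 1 / 4`. -/
noncomputable def specialTerm (a : ℂ) (n : ℕ) : ℂ :=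
  risingFactorial (1 / 2) n * risingFactorial (1 / 2 + 2 * a) n *
      risingFactorial (1 / 2 - 2 * a) n /
    (risingFactorial 1 n * risingFactorial (1 - 2 * a) n * risingFactorial (1 + 2 * a) n)

lemma wellPoisedTerm54_special (a : ℂ) (n : ℕ) :
    wellPoisedTerm54 (1 / 2) (1 / 2 + 2 * a) (1 / 2 - 2 * a) (1 / 4) n = specialTerm a n := by
  have h1 : risingFactorial (1 / 4) n ≠ 0 :=
    risingFactorial_ne_zero (add_natCast_ne_zero_of_re_pos (by norm_num)) n
  have h2 : risingFactorial (5 / 4) n ≠ 0 :=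
    risingFactorial_ne_zero (add_natCast_ne_zero_of_re_pos (by norm_num)) n
  simp only [wellPoisedTerm54, hypergeometricTerm, Fin.prod_univ_five, Matrix.cons_val, one_pow,
    mul_one, specialTerm]
  rw [show (1 : ℂ) + 1 / 2 / 2 = 5 / 4 by norm_num, show (1 / 2 / 2 : ℂ) = 1 / 4 by norm_num,
    show (1 : ℂ) + 1 / 2 - 1 / 4 = 5 / 4 by norm_num,
    show 1 + 1 / 2 - (1 / 2 + 2 * a) = 1 - 2 * a by ring,
    show 1 + 1 / 2 - (1 / 2 - 2 * a) = 1 + 2 * a by ring,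
    ← mul_div_mul_left (risingFactorial (1 / 2) n * _ * _) _
      (mul_ne_zero h1 h2)]
  congr 1 <;> ring

lemma wellPoisedTerm65_special (a : ℂ) (n : ℕ) :
    wellPoisedTerm65 (1 / 2) (1 / 2 + 2 * a) (1 / 4) n = (-1) ^ n * specialTerm a n := by
  have h1 : risingFactorial (1 / 4) n ≠ 0 :=
    risingFactorial_ne_zero (add_natCast_ne_zero_of_re_pos (by norm_num)) n
  have h2 : risingFactorial (5 / 4) n ≠ 0 :=
    risingFactorial_ne_zero (add_natCast_ne_zero_of_re_pos (by norm_num)) n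
  have h3 : risingFactorial (3 / 4) n ≠ 0 :=
    risingFactorial_ne_zero (add_natCast_ne_zero_of_re_pos (by norm_num)) n
  simp only [wellPoisedTerm65, hypergeometricTerm, Fin.prod_univ_six, Matrix.cons_val, specialTerm]
  rw [mul_comm]
  congr 1
  rw [show (1 : ℂ) + 1 / 2 / 2 = 5 / 4 by norm_num, show (1 / 2 / 2 : ℂ) = 1 / 4 by norm_num,
    show (1 : ℂ) + 1 / 2 - 1 / 4 = 5 / 4 by norm_num, show (1 : ℂ) - 1 / 4 = 3 / 4 by norm_num,
    show (1 / 2 : ℂ) + 1 / 4 = 3 / 4 by norm_num,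
    show 1 + 1 / 2 - (1 / 2 + 2 * a) = 1 - 2 * a by ring,
    show 1 / 2 + (1 / 2 + 2 * a) = 1 + 2 * a by ring,
    show 1 - (1 / 2 + 2 * a) = 1 / 2 - 2 * a by ring,
    ← mul_div_mul_left (risingFactorial (1 / 2) n * _ * _) _
      (mul_ne_zero (mul_ne_zero h1 h2) h3)]
  congr 1 <;> ring

lemma hypergeometricTerm_eq_specialTerm (a : ℂ) (k : ℕ) :
    hypergeometricTerm
      ![1 / 4, 3 / 4, 1 / 4 + a, 3 / 4 + a, 1 / 4 - a, 3 / 4 - a]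
      ![1, 1 / 2, 1 - a, 1 / 2 - a, 1 + a, 1 / 2 + a] 1 k = specialTerm a (2 * k) := by
  have h4 : (4 : ℂ) ^ k * 4 ^ k * 4 ^ k ≠ 0 := by simp
  simp only [hypergeometricTerm, Fin.prod_univ_six, Matrix.cons_val, one_pow, mul_one, specialTerm,
    risingFactorial_two_mul]
  rw [← mul_div_mul_left _ _ h4]
  rw [show (1 / 2 / 2 : ℂ) = 1 / 4 by norm_num, show ((1 / 2 + 1) / 2 : ℂ) = 3 / 4 by norm_num,
    show ((1 + 1) / 2 : ℂ) = 1 by norm_num,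
    show (1 / 2 + 2 * a) / 2 = 1 / 4 + a by ring, show (1 / 2 + 2 * a + 1) / 2 = 3 / 4 + a by ring,
    show (1 / 2 - 2 * a) / 2 = 1 / 4 - a by ring, show (1 / 2 - 2 * a + 1) / 2 = 3 / 4 - a by ring,
    show (1 - 2 * a) / 2 = 1 / 2 - a by ring, show (1 - 2 * a + 1) / 2 = 1 - a by ring,
    show (1 + 2 * a) / 2 = 1 / 2 + a by ring, show (1 + 2 * a + 1) / 2 = 1 + a by ring]
  congr 1 <;> ring

lemma Gamma_five_div_four : Complex.Gamma (5 / 4) = Complex.Gamma (1 / 4) / 4 := by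
  rw [show (5 / 4 : ℂ) = 1 / 4 + 1 by norm_num, Complex.Gamma_add_one _ (by norm_num)]
  ring

lemma Gamma_half_mul_Gamma_three_halves :
    Complex.Gamma (1 / 2) * Complex.Gamma (1 / 2 + 1) = (Real.pi : ℂ) / 2 := by
  have h := Complex.Gamma_mul_Gamma_one_sub (1 / 2)
  rw [show (1 : ℂ) - 1 / 2 = 1 / 2 by norm_num, mul_one_div, Complex.sin_pi_div_two, div_one] at h
  rw [Complex.Gamma_add_one _ (by norm_num)]
  linear_combination h / 2

lemma Gamma_one_fourth_mul_Gamma_three_fourths :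
    Complex.Gamma (1 / 4) * Complex.Gamma (3 / 4) = (Real.pi : ℂ) * (Real.sqrt 2 : ℂ) := by
  have h := Complex.Gamma_mul_Gamma_one_sub (1 / 4)
  have hs : Complex.sin ((Real.pi : ℂ) * (1 / 4)) = ((Real.sqrt 2 / 2 : ℝ) : ℂ) := by
    rw [← Real.sin_pi_div_four]
    push_cast
    congr 1
    ring
  have h2 : (Real.sqrt 2 : ℂ) ^ 2 = 2 := by
    rw [← Complex.ofReal_pow, Real.sq_sqrt (by norm_num)]
    norm_num
  have h0 : (Real.sqrt 2 : ℂ) ≠ 0 := by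
    intro h0
    rw [h0] at h2
    norm_num at h2
  rw [show (1 : ℂ) - 1 / 4 = 3 / 4 by norm_num, hs] at h
  rw [h]
  push_cast
  field_simp
  linear_combination -h2

lemma hasSum_specialTerm {a : ℂ} (hp : ∀ n : ℕ, 1 + 2 * a + n ≠ 0)
    (hm : ∀ n : ℕ, 1 - 2 * a + n ≠ 0) :
    HasSum (specialTerm a) (Complex.Gamma (1 + 2 * a) * Complex.Gamma (1 - 2 * a) *
      Complex.Gamma (1 / 4) ^ 2 /
        (2 * (Real.pi : ℂ) * (Complex.Gamma (3 / 4 - 2 * a) * Complex.Gamma (3 / 4 + 2 * a)))) := by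
  have e1 : 1 + 1 / 2 - (1 / 2 + 2 * a) = 1 - 2 * a := by ring
  have e2 : 1 + 1 / 2 - (1 / 2 - 2 * a) = 1 + 2 * a := by ring
  have e3 : (1 : ℂ) + 1 / 2 - 1 / 4 = 5 / 4 := by norm_num
  have e4 : 1 - 2 * a - (1 / 2 - 2 * a) - 1 / 4 = 1 / 4 := by ring
  have e5 : 1 - 2 * a - (1 / 2 - 2 * a) = 1 / 2 := by ring
  have e6 : 1 - 2 * a - 1 / 4 = 3 / 4 - 2 * a := by ring
  have e7 : 1 + 2 * a - 1 / 4 = 3 / 4 + 2 * a := by ring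
  have h := hasSum_wellPoisedTerm54 (a := 1 / 2) (b := 1 / 2 + 2 * a) (c := 1 / 2 - 2 * a)
    (d := 1 / 4) (add_natCast_ne_zero_of_re_pos (by norm_num)) (by rwa [e1]) (by rwa [e2])
    (by rw [e3]; exact add_natCast_ne_zero_of_re_pos (by norm_num))
    (by rw [e1, e4]; norm_num)
  rw [e1, e2, e3, e4, e5, e6, e7] at h
  convert h.congr_fun fun n => (wellPoisedTerm54_special a n).symm using 1
  rw [Gamma_five_div_four, mul_comm (Complex.Gamma (1 / 2 + 1)), Gamma_half_mul_Gamma_three_halves]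
  ring

lemma hasSum_neg_one_pow_mul_specialTerm {a : ℂ} (hp : ∀ n : ℕ, 1 + 2 * a + n ≠ 0)
    (hm : ∀ n : ℕ, 1 - 2 * a + n ≠ 0) :
    HasSum (fun n => (-1) ^ n * specialTerm a n)
      (Complex.Gamma (1 + 2 * a) * Complex.Gamma (1 - 2 * a) * (Real.sqrt 2 : ℂ) *
        (Real.pi : ℂ) / (2 * (Complex.Gamma (a + 5 / 8) * Complex.Gamma (a + 7 / 8) *
            Complex.Gamma (-a + 5 / 8) * Complex.Gamma (-a + 7 / 8)))) := by
  have e1 : 1 + 1 / 2 - (1 / 2 + 2 * a) = 1 - 2 * a := by ring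
  have e2 : 1 / 2 + (1 / 2 + 2 * a) = 1 + 2 * a := by ring
  have e3 : (1 : ℂ) + 1 / 2 - 1 / 4 = 5 / 4 := by norm_num
  have e4 : (1 / 2 : ℂ) + 1 / 4 = 3 / 4 := by norm_num
  have e5 : (1 - 2 * a + 1 / 4) / 2 = -a + 5 / 8 := by ring
  have e6 : (2 + 1 / 2 - (1 / 2 + 2 * a) - 1 / 4) / 2 = -a + 7 / 8 := by ring
  have e7 : (1 + 2 * a + 1 / 4) / 2 = a + 5 / 8 := by ring
  have e8 : (1 + 1 / 2 + (1 / 2 + 2 * a) - 1 / 4) / 2 = a + 7 / 8 := by ring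
  have e9 : (1 : ℂ) - 2 * (1 / 2) = 0 := by norm_num
  have h := hasSum_wellPoisedTerm65 (a := 1 / 2) (b := 1 / 2 + 2 * a) (d := 1 / 4)
    (by norm_num) (by rwa [e1]) (by rwa [e2])
    (by rw [e3]; exact add_natCast_ne_zero_of_re_pos (by norm_num))
    (by rw [e4]; exact add_natCast_ne_zero_of_re_pos (by norm_num))
  rw [e6, e8, e1, e2, e3, e4, e5, e7, e9, Complex.cpow_zero, Gamma_half_mul_Gamma_three_halves,
    Gamma_five_div_four] at h
  convert h.congr_fun fun n => (wellPoisedTerm65_special a n).symm using 1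
  have hpi : (Real.pi : ℂ) ≠ 0 := Complex.ofReal_ne_zero.mpr Real.pi_ne_zero
  have hg := Gamma_one_fourth_mul_Gamma_three_fourths
  rw [show Complex.Gamma (1 - 2 * a) * Complex.Gamma (1 + 2 * a) * (Complex.Gamma (1 / 4) / 4) *
    Complex.Gamma (3 / 4) = Complex.Gamma (1 - 2 * a) * Complex.Gamma (1 + 2 * a) *
    (Real.pi * (Real.sqrt 2 : ℂ) / 4) by rw [← hg]; ring]
  generalize Complex.Gamma (a + 5 / 8) = g₁, Complex.Gamma (a + 7 / 8) = g₂,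
    Complex.Gamma (-a + 5 / 8) = g₃, Complex.Gamma (-a + 7 / 8) = g₄
  simp only [div_eq_mul_inv, mul_inv]
  field_simp
  ring

theorem mainTheorem12 (a : ℂ) (ha : ∀ n : ℤ, n ≠ 0 → 2 * a ≠ (n : ℂ)) :
    Summable (hypergeometricTerm
      ![1 / 4, 3 / 4, 1 / 4 + a, 3 / 4 + a, 1 / 4 - a, 3 / 4 - a]
      ![1, 1 / 2, 1 - a, 1 / 2 - a, 1 + a, 1 / 2 + a] 1) ∧
    hypergeometricSeries
      ![1 / 4, 3 / 4, 1 / 4 + a, 3 / 4 + a, 1 / 4 - a, 3 / 4 - a]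
      ![1, 1 / 2, 1 - a, 1 / 2 - a, 1 + a, 1 / 2 + a] 1 =
    Complex.Gamma (1 + 2 * a) * Complex.Gamma (1 - 2 * a) / (4 * (Real.pi : ℂ)) *
      (Complex.Gamma (1 / 4) ^ 2 /
          (Complex.Gamma (3 / 4 - 2 * a) * Complex.Gamma (3 / 4 + 2 * a)) +
        (Real.sqrt 2 : ℂ) * (Real.pi : ℂ) ^ 2 /
          (Complex.Gamma (a + 5 / 8) * Complex.Gamma (a + 7 / 8) *
            Complex.Gamma (-a + 5 / 8) * Complex.Gamma (-a + 7 / 8))) := by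
  have hp : ∀ n : ℕ, 1 + 2 * a + n ≠ 0 := by
    intro n h
    refine ha (-(n + 1 : ℤ)) (by omega) ?_
    push_cast
    linear_combination h
  have hm : ∀ n : ℕ, 1 - 2 * a + n ≠ 0 := by
    intro n h
    refine ha (n + 1 : ℤ) (by omega) ?_
    push_cast
    linear_combination -h
  have h := ((hasSum_specialTerm hp hm).even_part
    (hasSum_neg_one_pow_mul_specialTerm hp hm)).congr_fun (hypergeometricTerm_eq_specialTerm a)
  refine ⟨h.summable, h.tsum_eq.trans ?_⟩
  have hpi : (Real.pi : ℂ) ≠ 0 := Complex.ofReal_ne_zero.mpr Real.pi_ne_zero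
  generalize Complex.Gamma (a + 5 / 8) = g₁, Complex.Gamma (a + 7 / 8) = g₂,
    Complex.Gamma (-a + 5 / 8) = g₃, Complex.Gamma (-a + 7 / 8) = g₄,
    Complex.Gamma (3 / 4 - 2 * a) = g₅, Complex.Gamma (3 / 4 + 2 * a) = g₆
  simp only [div_eq_mul_inv, mul_inv]
  field_simp
  ring
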